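/- **Theorem (Bound on the estimation error).** There is a universal constant $C>0$, independent of the dimension $d$ and of all the other data below, such that the following holds. *Setting.* Let $d\ge 1$, let $D\subset\mathbb{R}^d$ be compact, let $m\ge1$, and let $X=\{\mathbf{x}_j\}_{j=1}^m\subset D$ satisfy $\|\mathbf{x}_j-\mathbf{x}_{j'}\|_2\ge K$ for all $j\ne j'$, where $K>0$ is a constant. Let $$h_X=\max_{\mathbf{x}\in D}\min_{1\le j\le m}\|\mathbf{x}-\mathbf{x}_j\|_2$$ be the fill-in distance of $X$. Let $\gamma>0$, let $\rho(\boldsymbol\omega)=\prod_{j=1}^d\frac{1}{\pi\gamma(1+\omega_j^2/\gamma^2)}$ be the density of the tensor-product Cauchy distribution on $\mathbb{R}^d$, and let $\boldsymbol\omega_1,\dots,\boldsymbol\omega_N$ be i.i.d. samples from it. Let $f$ be a function of the form $f(\mathbf{x})=\int_{\mathbb{R}^d}\hat f(\boldsymbol\omega)e^{i\langle\boldsymbol\omega,\mathbf{x}\rangle}d\boldsymbol\omega$ with $$\|f\|_\rho^2=\mathbb{E}_{\boldsymbol\omega\sim\rho}\left|\frac{\hat f(\boldsymbol\omega)}{\rho(\boldsymbol\omega)}\right|^2<\infty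 .$$ Let $T>0$, let $\alpha=\hat f/\rho$, let $\alpha_{\le T}=\alpha\,\mathbf 1_{|\alpha|\le T}$, and put $$f^*(\mathbf{x})=\frac1N\sum_{k=1}^N\alpha_{\le T}(\boldsymbol\omega_k)e^{i\langle\boldsymbol\omega_k,\mathbf{x}\rangle},\qquad f^\sharp(\mathbf{x})=\sum_{k=1}^N c^\sharp_k e^{i\langle\boldsymbol\omega_k,\mathbf{x}\rangle},\qquad \mathbf{c}^\sharp\in\operatorname*{argmin}_{\mathbf{c}\in\mathbb{C}^N,\ \mathbf{A}\mathbf{c}=\mathbf{y}}\|\mathbf{c}\|_2,$$ where $\mathbf{A}\in\mathbb{C}^{m\times N}$ has entries $\mathbf{A}_{j,k}=e^{i\langle\boldsymbol\omega_k,\mathbf{x}_j\rangle}$ and $\mathbf{y}=(f(\mathbf{x}_j))_{j=1}^m$. *Claim.* Suppose that, for some $\eta\in(0,\tfrac12)$ and $\delta>0$, $$N\ge C\eta^{-2}m\log\left(\frac{m}{2\delta}\right)\qquad\text{and}\qquad \gamma\ge\frac1K\log\left(\frac m\eta\right).$$ Then with probability at least $1-4\delta$ the minimization problem that defines $\mathbf{c}^\sharp$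 has a solution, and for every $L_f>0$ such that $f^*-f^\sharp$ is $L_f$-Lipschitz on $D$, i.e. $|(f^*-f^\sharp)(\mathbf{x})-(f^*-f^\sharp)(\mathbf{x}')|\le L_f\|\mathbf{x}-\mathbf{x}'\|_2$ for all $\mathbf{x},\mathbf{x}'\in D$, one has $$\|f^*-f^\sharp\|^2_{L^2(D)}\le 2L_f^2h_X^2\operatorname{vol}(D)+C\,h_X^d(1+2\eta)\left(\frac{2m}{1-2\eta}I_1+2I_2\right),$$ where $$I_1=\frac{2\|f\|_\rho^4}{T^2}+\frac{32T^2\log^2(2/\delta)}{N^2}+\frac{4\|f\|_\rho^2\log(2/\delta)}{N},\qquad I_2=\|f\|_\rho^2+\frac{4T^2\log(2/\delta)}{N}+\sqrt{\frac{2T^2\|f\|_\rho^2\log(2/\delta)}{N}} .$$ -/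

import Mathlib

open MeasureTheory ProbabilityTheory

noncomputable section

namespace CauchyRF

/-- The Euclidean space `ℝ^d` (with the Euclidean norm and Lebesgue measure). -/
abbrev Rd (d : ℕ) : Type := EuclideanSpace ℝ (Fin d)

/-- The density of the tensor-product Cauchy distribution with scaling parameter `γ`. -/
def cauchyDensity {d : ℕ} (γ : ℝ) (w : Rd d) : ℝ :=
  ∏ j : Fin d, 1 / (Real.pi * γ * (1 + (w j) ^ 2 / γ ^ 2))

/-- The tensor-product Cauchy distribution on `ℝ^d`. -/
def tensorCauchy (d : ℕ) (γ : ℝ) : Measure (Rd d) :=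
  volume.withDensity fun w => ENNReal.ofReal (cauchyDensity γ w)

/-- The random Fourier feature `exp(i ⟨w, x⟩)`. -/
def feature {d : ℕ} (w x : Rd d) : ℂ :=
  Complex.exp (Complex.I * ((inner ℝ w x : ℝ) : ℂ))

/-- The ratio `α = f̂ / ρ`. -/
def alpha {d : ℕ} (γ : ℝ) (fhat : Rd d → ℂ) (w : Rd d) : ℂ :=
  fhat w / ((cauchyDensity γ w : ℝ) : ℂ)

/-- The function `f` belongs to the space `F(ρ)`, with Fourier transform `f̂`, in the normalization
`f(x) = ∫ f̂(w) exp(i ⟨w, x⟩) dw`. The finiteness of `E_w |f̂(w) / ρ(w)|²` makes `f̂` integrable, so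
the integral converges absolutely and `f` determines `f̂` almost everywhere. -/
structure MemF {d : ℕ} (γ : ℝ) (f fhat : Rd d → ℂ) : Prop where
  aestronglyMeasurable : AEStronglyMeasurable fhat volume
  eq_integral : ∀ x, f x = ∫ w, fhat w * feature w x
  finite_norm : Integrable (fun w => ‖alpha γ fhat w‖ ^ 2) (tensorCauchy d γ)

/-- The norm `‖f‖_ρ = (E_w |f̂(w) / ρ(w)|²)^(1/2)`. -/
def rhoNorm {d : ℕ} (γ : ℝ) (fhat : Rd d → ℂ) : ℝ :=
  Real.sqrt (∫ w, ‖alpha γ fhat w‖ ^ 2 ∂(tensorCauchy d γ))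

open Classical in
/-- The truncation `α_{≤ T}`. -/
def alphaTrunc {d : ℕ} (γ : ℝ) (fhat : Rd d → ℂ) (T : ℝ) (w : Rd d) : ℂ :=
  if ‖alpha γ fhat w‖ ≤ T then alpha γ fhat w else 0

/-- The best random feature model `f^*` built on the features `w 1, …, w N`. -/
def fStar {d N : ℕ} (γ : ℝ) (fhat : Rd d → ℂ) (T : ℝ) (w : Fin N → Rd d) (x : Rd d) : ℂ :=
  (1 / (N : ℂ)) * ∑ k : Fin N, alphaTrunc γ fhat T (w k) * feature (w k) x

/-- The random feature matrix `A`, with entries `exp(i ⟨w_k, x_j⟩)`. -/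
def featureMatrix {d m N : ℕ} (x : Fin m → Rd d) (w : Fin N → Rd d) :
    Matrix (Fin m) (Fin N) ℂ :=
  Matrix.of fun j k => feature (w k) (x j)

/-- `c` is a solution of the problem of minimizing `‖c‖₂` subject to `A c = y`. -/
def IsMinNormInterpolant {m N : ℕ} (A : Matrix (Fin m) (Fin N) ℂ) (y : Fin m → ℂ)
    (c : EuclideanSpace ℂ (Fin N)) : Prop :=
  A.mulVec c.ofLp = y ∧
    ∀ c' : EuclideanSpace ℂ (Fin N), A.mulVec c'.ofLp = y → ‖c‖ ≤ ‖c'‖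

/-- The random feature model with features `w` and coefficients `c`. -/
def rfModel {d N : ℕ} (w : Fin N → Rd d) (c : EuclideanSpace ℂ (Fin N)) (x : Rd d) : ℂ :=
  ∑ k : Fin N, c k * feature (w k) x

/-- The fill-in distance `h_X = max_{y ∈ D} min_j ‖y - x_j‖₂`. -/
def fillDistance {d m : ℕ} (D : Set (Rd d)) (x : Fin m → Rd d) : ℝ :=
  ⨆ y : D, ⨅ j : Fin m, ‖(y : Rd d) - x j‖

/-- The function `g` is `L`-Lipschitz on `D`. -/
def IsLipschitzOn {d : ℕ} (D : Set (Rd d)) (L : ℝ) (g : Rd d → ℂ) : Prop :=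
  ∀ y₁ ∈ D, ∀ y₂ ∈ D, ‖g y₁ - g y₂‖ ≤ L * ‖y₁ - y₂‖

/-- The norm of `L²(D)`. -/
def l2Norm {d : ℕ} (D : Set (Rd d)) (g : Rd d → ℂ) : ℝ :=
  Real.sqrt (∫ y in D, ‖g y‖ ^ 2)

/-- The quantity `I₁`, where `R` stands for `‖f‖_ρ`. -/
def I1 (R T δ : ℝ) (N : ℕ) : ℝ :=
  2 * R ^ 4 / T ^ 2 + 32 * T ^ 2 * (Real.log (2 / δ)) ^ 2 / (N : ℝ) ^ 2 +
    4 * R ^ 2 * Real.log (2 / δ) / (N : ℝ)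

/-- The quantity `I₂`, where `R` stands for `‖f‖_ρ`. -/
def I2 (R T δ : ℝ) (N : ℕ) : ℝ :=
  R ^ 2 + 4 * T ^ 2 * Real.log (2 / δ) / (N : ℝ) +
    Real.sqrt (2 * T ^ 2 * R ^ 2 * Real.log (2 / δ) / (N : ℝ))

/-- The property `P` holds with probability at least `p`: it holds throughout a measurable event
of probability at least `p`. -/
def WithProbAtLeast {Ω : Type*} [MeasurableSpace Ω] (μ : Measure Ω) (p : ℝ) (P : Ω → Prop) :
    Prop :=
  ∃ E : Set Ω, MeasurableSet E ∧ ENNReal.ofReal p ≤ μ E ∧ ∀ s ∈ E, P s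

end CauchyRF

end

open MeasureTheory ProbabilityTheory CauchyRF

open MeasureTheory ProbabilityTheory

/-! Since the coefficients solve `A c = y`, the model `f^♯` agrees with `f` at the nodes, so `f^* -
f^♯` takes there the values of `f^* - f`. Only the constraint matters, not the minimality of the
norm, so no estimate of the singular values of `A` enters.

From nodes to `D` (`l2Norm_sq_le`): each point of `D` lies within `h_X` of a node, so the Lipschitz
bound and a cover by balls of radius `h_X` control the `L²` norm by the sum of squares over the
nodes. The ball volume is at most `exp π * h_X ^ d` in every dimension, which makes the constant
universal.

At the nodes (`measureReal_sum_fStar_sub_sq_gt_le`): `(f^*(x_j))_j` is an average of `N` i.i.d.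
vectors of `ℂ^m` of norm at most `T √m`. Its bias from truncation is at most `‖f‖_ρ² / T` per node,
and its fluctuation obeys a dimension-free Bernstein inequality in Hilbert space. Together they give
`4 m I₁` outside an event of probability `δ`.

Solvability (`ae_exists_mulVec_eq`): once `m ≤ N`, an `m × m` block of `A` has as determinant a
nonzero trigonometric polynomial in the frequencies, which vanishes only on a null set.

The term `I₂` enters only through its nonnegativity. -/

namespace CauchyRF

/-! ### Bernstein's inequality for sums of independent vectors in a Hilbert space. -/

section Concentration

/-- A second-order bound for `cosh ‖x + y‖`, whose last term is linear in `y`. -/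
lemma cosh_norm_add_le {E : Type*} [NormedAddCommGroup E] [InnerProductSpace ℝ E] (x y : E) :
    Real.cosh ‖x + y‖ ≤ Real.cosh ‖x‖ * (Real.exp ‖y‖ - ‖y‖) +
      inner ℝ ((Real.sinh ‖x‖ / ‖x‖) • x) y := by
  rcases eq_or_ne x 0 with rfl | hx
  -- At `x = 0` the inner product vanishes and the claim is `cosh b ≤ exp b - b`, that is `b ≤ sinh
  -- b`.
  · have h := Real.self_le_sinh_iff.2 (norm_nonneg y)
    have h2 := Real.cosh_add_sinh ‖y‖
    simp
    linarith
  rcases eq_or_ne y 0 with rfl | hy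
  · simp
  have ha : 0 < ‖x‖ := norm_pos_iff.2 hx
  have hb : 0 < ‖y‖ := norm_pos_iff.2 hy
  set a := ‖x‖ with ha'
  set b := ‖y‖ with hb'
  -- `c` is the cosine of the angle between `x` and `y`. It makes `‖x + y‖²` a convex combination of
  -- `(a + b)²` and `(a - b)²`.
  obtain ⟨c, hc⟩ : ∃ c : ℝ, c * (a * b) = inner ℝ x y :=
    ⟨inner ℝ x y / (a * b), by field_simp⟩
  have hcabs : |c| ≤ 1 := by
    have h := abs_real_inner_le_norm x y
    rw [← hc, abs_mul, abs_of_pos (mul_pos ha hb)] at h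
    exact le_of_mul_le_mul_right (by linarith) (mul_pos ha hb)
  obtain ⟨hc1, hc2⟩ := abs_le.1 hcabs
  have hsq : ‖x + y‖ ^ 2 = (1 + c) / 2 * (a + b) ^ 2 + (1 - c) / 2 * (a - b) ^ 2 := by
    rw [norm_add_sq_real, ← hc]; ring
  -- `cosh √u` is a power series in `u` with nonnegative coefficients, hence convex; convexity is
  -- applied term by term.
  have key : Real.cosh ‖x + y‖ ≤
      (1 + c) / 2 * Real.cosh (a + b) + (1 - c) / 2 * Real.cosh (a - b) := by
    refine hasSum_le (fun n => ?_) (Real.hasSum_cosh ‖x + y‖)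
      (((Real.hasSum_cosh (a + b)).mul_left _).add ((Real.hasSum_cosh (a - b)).mul_left _))
    have h := (convexOn_pow (𝕜 := ℝ) n).2 (sq_nonneg (a + b)) (sq_nonneg (a - b))
      (show 0 ≤ (1 + c) / 2 by linarith) (show 0 ≤ (1 - c) / 2 by linarith) (by ring)
    simp only [smul_eq_mul] at h
    rw [← hsq, ← pow_mul, ← pow_mul, ← pow_mul] at h
    calc _ ≤ _ := div_le_div_of_nonneg_right h (by positivity)
      _ = _ := by ring
  -- The addition formulas turn `key` into `cosh a cosh b + c sinh a sinh b`. Only the part of `sinh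
  -- b` beyond `b` is estimated; the remaining `c sinh a * b` is exactly the inner product, which
  -- later averages to zero.
  have hs : c * Real.sinh a * (Real.sinh b - b) ≤ Real.cosh a * (Real.sinh b - b) := by
    refine mul_le_mul_of_nonneg_right ?_ (sub_nonneg.2 (Real.self_le_sinh_iff.2 hb.le))
    have h1 := Real.sinh_pos_iff.2 ha
    have h2 := Real.sinh_lt_cosh a
    nlinarith
  have hi : inner ℝ ((Real.sinh a / a) • x) y = c * Real.sinh a * b := by
    rw [real_inner_smul_left, ← hc]; field_simp
  rw [hi, ← Real.cosh_add_sinh b]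
  rw [Real.cosh_add, Real.cosh_sub] at key
  nlinarith

variable {Ω ι E : Type*} [MeasurableSpace Ω] {μ : Measure Ω} [IsProbabilityMeasure μ]
  [NormedAddCommGroup E] [InnerProductSpace ℝ E] [CompleteSpace E] [MeasurableSpace E]
  [BorelSpace E] [SecondCountableTopology E]

lemma exp_sub_self_le {b : ℝ} (h0 : 0 ≤ b) (h1 : b ≤ 1) : Real.exp b - b ≤ 1 + b ^ 2 := by
  have := (abs_le.1 (Real.abs_exp_sub_one_sub_id_le (x := b) (by rwa [abs_of_nonneg h0]))).2
  linarith

/-- The expected `cosh` of the norm of a sum of independent centred vectors of norm at most `1`. -/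
lemma integral_cosh_norm_sum_le {X : ι → Ω → E} (hX : ∀ i, Measurable (X i))
    (hind : iIndepFun X μ) (hb : ∀ i s, ‖X i s‖ ≤ 1) (hmean : ∀ i, ∫ s, X i s ∂μ = 0)
    {v : ℝ} (hvar : ∀ i, ∫ s, ‖X i s‖ ^ 2 ∂μ ≤ v) (t : Finset ι) :
    ∫ s, Real.cosh ‖∑ i ∈ t, X i s‖ ∂μ ≤ (1 + v) ^ t.card := by
  classical
  induction t using Finset.induction_on with
  | empty => simp
  | insert k t hk ih =>
    set S : Ω → E := fun s => ∑ i ∈ t, X i s with hS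
    have hSm : Measurable S := Finset.measurable_sum _ fun i _ => hX i
    have hSb : ∀ s, ‖S s‖ ≤ t.card := fun s =>
      (norm_sum_le _ _).trans ((Finset.sum_le_sum fun i _ => hb i s).trans (by simp))
    have hindk : IndepFun S (X k) μ := by
      have := hind.indepFun_finsetSum_of_notMem hX hk
      convert! this using 1
      ext s; simp [hS]
    have hcosh_mono : ∀ {u w : ℝ}, 0 ≤ u → u ≤ w → Real.cosh u ≤ Real.cosh w := fun h0 h =>
      Real.cosh_le_cosh.2 (by rwa [abs_of_nonneg h0, abs_of_nonneg (h0.trans h)])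
    have hcm : Measurable fun s => Real.cosh ‖S s‖ := Real.measurable_cosh.comp hSm.norm
    have hci : Integrable (fun s => Real.cosh ‖S s‖) μ :=
      Integrable.of_bound hcm.aestronglyMeasurable (Real.cosh t.card) (.of_forall fun s => by
        rw [Real.norm_of_nonneg (Real.cosh_pos _).le]
        exact hcosh_mono (norm_nonneg _) (hSb s))
    -- This is the gradient of `cosh ‖x‖`. Its pairing with `X k` has mean zero because `X k` is
    -- centred and independent of `S`.
    set φ : E → E := fun x => (Real.sinh ‖x‖ / ‖x‖) • x with hφ
    have hφm : Measurable φ :=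
      ((Real.measurable_sinh.comp measurable_norm).div measurable_norm).smul measurable_id
    have hφn : ∀ x, ‖φ x‖ ≤ Real.cosh ‖x‖ := fun x => by
      rcases eq_or_ne x 0 with rfl | hx
      · simp [hφ]
      · have hx' := norm_pos_iff.2 hx
        rw [hφ, norm_smul, Real.norm_of_nonneg (div_nonneg (Real.sinh_nonneg_iff.2 hx'.le) hx'.le),
          div_mul_cancel₀ _ hx'.ne']
        exact (Real.sinh_lt_cosh _).le
    have hφi : Integrable (fun s => φ (S s)) μ :=
      hci.mono' (hφm.comp hSm).aestronglyMeasurable (.of_forall fun s => hφn _)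
    have hψm : Measurable fun y : E => Real.exp ‖y‖ - ‖y‖ :=
      (Real.measurable_exp.comp measurable_norm).sub measurable_norm
    have hXi : Integrable (X k) μ :=
      Integrable.of_bound (hX k).aestronglyMeasurable 1 (.of_forall (hb k))
    have hX2i : Integrable (fun s => ‖X k s‖ ^ 2) μ :=
      Integrable.of_bound ((hX k).norm.pow_const 2).aestronglyMeasurable 1 (.of_forall fun s => by
        rw [Real.norm_of_nonneg (by positivity)]
        exact pow_le_one₀ (norm_nonneg _) (hb k s))
    have hψ : ∀ s, Real.exp ‖X k s‖ - ‖X k s‖ ≤ 1 + ‖X k s‖ ^ 2 := fun s =>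
      exp_sub_self_le (norm_nonneg _) (hb k s)
    have hψ0 : ∀ s, 0 ≤ Real.exp ‖X k s‖ - ‖X k s‖ := fun s => by
      linarith [Real.add_one_le_exp ‖X k s‖]
    have hψi : Integrable (fun s => Real.exp ‖X k s‖ - ‖X k s‖) μ :=
      ((integrable_const (1 : ℝ)).add hX2i).mono' (hψm.comp (hX k)).aestronglyMeasurable
        (.of_forall fun s => by rw [Real.norm_of_nonneg (hψ0 s)]; exact hψ s)
    have hind1 : IndepFun (fun s => Real.cosh ‖S s‖) (fun s => Real.exp ‖X k s‖ - ‖X k s‖) μ :=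
      hindk.comp (Real.measurable_cosh.comp measurable_norm) hψm
    have hind2 : IndepFun (fun s => φ (S s)) (X k) μ := hindk.comp hφm measurable_id
    have hI1 : Integrable (fun s => Real.cosh ‖S s‖ * (Real.exp ‖X k s‖ - ‖X k s‖)) μ :=
      hind1.integrable_mul hci hψi
    have hI2 : Integrable (fun s => inner ℝ (φ (S s)) (X k s)) μ :=
      hind2.integrable_bilin hφi hXi (innerSL ℝ)
    have e1 : ∫ s, Real.cosh ‖S s‖ * (Real.exp ‖X k s‖ - ‖X k s‖) ∂μ =
        (∫ s, Real.cosh ‖S s‖ ∂μ) * ∫ s, (Real.exp ‖X k s‖ - ‖X k s‖) ∂μ :=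
      hind1.integral_mul_eq_mul_integral hcm.aestronglyMeasurable hψi.aestronglyMeasurable
    have e2 : ∫ s, inner ℝ (φ (S s)) (X k s) ∂μ = 0 := by
      have h := hind2.integral_bilin hφi hXi (innerSL ℝ)
      rw [hmean k, map_zero] at h
      exact h
    have hv : ∫ s, (Real.exp ‖X k s‖ - ‖X k s‖) ∂μ ≤ 1 + v := by
      calc _ ≤ ∫ s, (1 + ‖X k s‖ ^ 2) ∂μ :=
            integral_mono hψi ((integrable_const (1 : ℝ)).add hX2i) hψ
        _ = 1 + ∫ s, ‖X k s‖ ^ 2 ∂μ := by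
            rw [integral_add (integrable_const _) hX2i]; simp
        _ ≤ 1 + v := by linarith [hvar k]
    calc ∫ s, Real.cosh ‖∑ i ∈ insert k t, X i s‖ ∂μ
        ≤ ∫ s, (Real.cosh ‖S s‖ * (Real.exp ‖X k s‖ - ‖X k s‖) +
            inner ℝ (φ (S s)) (X k s)) ∂μ := by
          refine integral_mono_of_nonneg (.of_forall fun s => (Real.cosh_pos _).le)
            (hI1.add hI2) (.of_forall fun s => ?_)
          simp only [Finset.sum_insert hk]
          rw [add_comm]
          exact cosh_norm_add_le _ _
      _ = (∫ s, Real.cosh ‖S s‖ ∂μ) * ∫ s, (Real.exp ‖X k s‖ - ‖X k s‖) ∂μ := by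
          rw [integral_add hI1 hI2, e2, add_zero]
          exact e1
      _ ≤ (1 + v) ^ t.card * (1 + v) :=
          mul_le_mul ih hv (integral_nonneg hψ0)
            ((integral_nonneg fun s => (Real.cosh_pos _).le).trans ih)
      _ = (1 + v) ^ (insert k t).card := by rw [Finset.card_insert_of_notMem hk, pow_succ]

/-- A Chernoff bound for the norm of a sum of independent centred bounded vectors. -/
lemma measureReal_norm_sum_ge_le [Fintype ι] {X : ι → Ω → E} (hX : ∀ i, Measurable (X i))
    (hind : iIndepFun X μ) {M : ℝ} (hb : ∀ i s, ‖X i s‖ ≤ M) (hmean : ∀ i, ∫ s, X i s ∂μ = 0)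
    {v : ℝ} (hvar : ∀ i, ∫ s, ‖X i s‖ ^ 2 ∂μ ≤ v) (hv : 0 ≤ v) {l : ℝ} (hl : 0 < l)
    (hlM : l * M ≤ 1) (r : ℝ) :
    μ.real {s | r ≤ ‖∑ i, X i s‖} ≤
      2 * Real.exp (Fintype.card ι * (l ^ 2 * v) - l * r) := by
  have h := integral_cosh_norm_sum_le (X := fun i s => l • X i s) (v := l ^ 2 * v) (μ := μ)
    (fun i => (hX i).const_smul l)
    (hind.comp (fun _ x => l • x) fun _ => measurable_id.const_smul l)
    (fun i s => by
      rw [norm_smul, Real.norm_of_nonneg hl.le]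
      exact (mul_le_mul_of_nonneg_left (hb i s) hl.le).trans hlM)
    (fun i => by rw [integral_smul, hmean i, smul_zero])
    (fun i => by
      simp only [norm_smul, Real.norm_of_nonneg hl.le, mul_pow, integral_const_mul]
      exact mul_le_mul_of_nonneg_left (hvar i) (by positivity)) Finset.univ
  simp only [← Finset.smul_sum, norm_smul, Real.norm_of_nonneg hl.le, Finset.card_univ] at h
  have hm : Measurable fun s => ‖∑ i, X i s‖ :=
    (Finset.measurable_sum _ fun i _ => hX i).norm
  have hci : Integrable (fun s => Real.cosh (l * ‖∑ i, X i s‖)) μ := by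
    refine Integrable.of_bound
      (Real.measurable_cosh.comp (hm.const_mul l)).aestronglyMeasurable
      (Real.cosh (l * (Fintype.card ι * M))) (.of_forall fun s => ?_)
    rw [Real.norm_of_nonneg (Real.cosh_pos _).le]
    have h0 : ‖∑ i, X i s‖ ≤ Fintype.card ι * M :=
      (norm_sum_le _ _).trans ((Finset.sum_le_sum fun i _ => hb i s).trans (by simp))
    have h1 : 0 ≤ ‖∑ i, X i s‖ := norm_nonneg _
    rw [Real.cosh_le_cosh, abs_of_nonneg (by positivity),
      abs_of_nonneg (mul_nonneg hl.le (h1.trans h0))]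
    exact mul_le_mul_of_nonneg_left h0 hl.le
  -- Markov's inequality for `cosh`; the factor 2 of the conclusion comes from `cosh u ≥ exp u / 2`.
  have hmk := mul_meas_ge_le_integral_of_nonneg (μ := μ)
    (.of_forall fun s => (Real.cosh_pos (l * ‖∑ i, X i s‖)).le) hci (Real.exp (l * r) / 2)
  have hsub : μ.real {s | r ≤ ‖∑ i, X i s‖} ≤
      μ.real {s | Real.exp (l * r) / 2 ≤ Real.cosh (l * ‖∑ i, X i s‖)} := by
    refine measureReal_mono fun s hs => ?_
    have h1 := Real.exp_le_exp.2 (mul_le_mul_of_nonneg_left hs hl.le)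
    simp only [Set.mem_ofPred_eq, Real.cosh_eq]
    have h2 := Real.exp_pos (-(l * ‖∑ i, X i s‖))
    linarith
  have hpow : (1 + l ^ 2 * v) ^ Fintype.card ι ≤ Real.exp (Fintype.card ι * (l ^ 2 * v)) := by
    rw [Real.exp_nat_mul]
    exact pow_le_pow_left₀ (by positivity) (by linarith [Real.add_one_le_exp (l ^ 2 * v)]) _
  rw [Real.exp_sub, mul_div_assoc', le_div_iff₀ (Real.exp_pos _)]
  have := mul_le_mul_of_nonneg_left hsub (Real.exp_pos (l * r)).le
  nlinarith

/-- Bernstein's inequality in a Hilbert space. -/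
lemma measureReal_norm_sum_ge_le_two_mul_exp [Fintype ι] {X : ι → Ω → E}
    (hX : ∀ i, Measurable (X i)) (hind : iIndepFun X μ) {M : ℝ} (hM : 0 < M)
    (hb : ∀ i s, ‖X i s‖ ≤ M) (hmean : ∀ i, ∫ s, X i s ∂μ = 0) {v : ℝ}
    (hvar : ∀ i, ∫ s, ‖X i s‖ ^ 2 ∂μ ≤ v) (hv : 0 ≤ v) {L : ℝ} (hL : 0 < L) :
    μ.real {s | 2 * M * L + 2 * √(L * (Fintype.card ι * v)) ≤ ‖∑ i, X i s‖} ≤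
      2 * Real.exp (-L) := by
  set n : ℝ := (Fintype.card ι : ℝ) with hn
  have hn0 : 0 ≤ n := Nat.cast_nonneg _
  -- The choice is `l = √(L / (n v))` when this respects `l M ≤ 1`, and `l = 1 / M` otherwise.
  -- Either way the Chernoff exponent is at most `L - 2 L`.
  obtain ⟨l, hl, hlM, h1, h2⟩ : ∃ l : ℝ, 0 < l ∧ l * M ≤ 1 ∧ n * (l ^ 2 * v) ≤ L ∧
      2 * L ≤ l * (2 * M * L + 2 * √(L * (n * v))) := by
    have hsq := Real.sqrt_nonneg (L * (n * v))
    by_cases hc : n * v ≤ L * M ^ 2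
    · refine ⟨1 / M, by positivity, by field_simp; rfl, ?_, ?_⟩
      · rw [show n * ((1 / M) ^ 2 * v) = n * v / M ^ 2 by field_simp]
        rwa [div_le_iff₀ (by positivity)]
      · rw [mul_add, show 1 / M * (2 * M * L) = 2 * L by field_simp]
        have : 0 ≤ 1 / M * (2 * √(L * (n * v))) := by positivity
        linarith
    · push Not at hc
      have hnv : 0 < n * v := lt_of_le_of_lt (by positivity) hc
      have hl2 : √(L / (n * v)) ^ 2 = L / (n * v) := Real.sq_sqrt (by positivity)
      refine ⟨√(L / (n * v)), by positivity, ?_, ?_, ?_⟩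
      · rw [← sq_le_one_iff₀ (by positivity), mul_pow, hl2, div_mul_eq_mul_div,
          div_le_one hnv]
        exact hc.le
      · rw [hl2, show n * (L / (n * v) * v) = (n * v) * (L / (n * v)) by ring,
          mul_div_cancel₀ _ hnv.ne']
      · rw [mul_add, show √(L / (n * v)) * (2 * √(L * (n * v))) =
          2 * (√(L / (n * v)) * √(L * (n * v))) by ring, ← Real.sqrt_mul (by positivity),
          show L / (n * v) * (L * (n * v)) = L ^ 2 by
            rw [div_mul_eq_mul_div, div_eq_iff hnv.ne']; ring, Real.sqrt_sq hL.le]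
        have : 0 ≤ √(L / (n * v)) * (2 * M * L) := by positivity
        linarith
  refine (measureReal_norm_sum_ge_le hX hind hb hmean hvar hv hl hlM _).trans ?_
  have : Real.exp (n * (l ^ 2 * v) - l * (2 * M * L + 2 * √(L * (n * v)))) ≤ Real.exp (-L) :=
    Real.exp_le_exp.2 (by linarith)
  linarith

end Concentration

/-! ### Almost sure solvability of the interpolation problem. -/

section FullRank

/-- The character `t ↦ exp(i c t)` of the real line. -/
noncomputable def expChar (c : ℝ) : Multiplicative ℝ →* ℂ where
  toFun t := Complex.exp (Complex.I * ((c * t.toAdd : ℝ) : ℂ))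
  map_one' := by simp
  map_mul' s t := by rw [← Complex.exp_add]; congr 1; push_cast [toAdd_mul]; ring

/-- At `t = π / (c - c')` the quotient of the two characters is `exp(iπ) = -1`. -/
lemma expChar_injective : Function.Injective expChar := by
  intro c c' h
  by_contra hne
  have hne' : c - c' ≠ 0 := sub_ne_zero.2 hne
  have h1 : Complex.exp (Complex.I * ((c * (Real.pi / (c - c')) : ℝ) : ℂ)) =
      Complex.exp (Complex.I * ((c' * (Real.pi / (c - c')) : ℝ) : ℂ)) :=
    DFunLike.congr_fun h (Multiplicative.ofAdd (Real.pi / (c - c')))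
  have h2 : Complex.exp (Real.pi * Complex.I) = 1 := by
    rw [← sub_eq_zero.1 (show Complex.I * ((c * (Real.pi / (c - c')) : ℝ) : ℂ) -
      Complex.I * ((c' * (Real.pi / (c - c')) : ℝ) : ℂ) - Real.pi * Complex.I = 0 by
        rw [← mul_sub, ← Complex.ofReal_sub, ← sub_mul, mul_div_cancel₀ _ hne']; ring),
      Complex.exp_sub, h1, div_self (Complex.exp_ne_zero _)]
  rw [Complex.exp_pi_mul_I] at h2
  norm_num at h2

/-- A nonzero trigonometric polynomial on the line vanishes only on a null set. -/
lemma ae_trigSum_real_ne_zero {ι : Type*} [Fintype ι] {c : ι → ℝ} (hc : Function.Injective c)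
    {a : ι → ℂ} (ha : a ≠ 0) :
    ∀ᵐ t : ℝ, ∑ i, a i * Complex.exp (Complex.I * ((c i * t : ℝ) : ℂ)) ≠ 0 := by
  -- By Dedekind's independence of characters the sum is not identically zero. Being real analytic,
  -- it then has a discrete, hence null, zero set.
  have hli := (linearIndependent_monoidHom (Multiplicative ℝ) ℂ).comp (fun i => expChar (c i))
    (expChar_injective.comp hc)
  obtain ⟨t₀, ht₀⟩ : ∃ t : ℝ, ∑ i, a i * Complex.exp (Complex.I * ((c i * t : ℝ) : ℂ)) ≠ 0 := by
    by_contra! h0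
    refine ha (funext (Fintype.linearIndependent_iff.1 hli a (funext fun t => ?_)))
    simpa [expChar] using h0 t.toAdd
  have han : AnalyticOnNhd ℝ
      (fun t : ℝ => ∑ i, a i * Complex.exp (Complex.I * ((c i * t : ℝ) : ℂ))) Set.univ := by
    intro t _
    refine Finset.analyticAt_fun_sum _ fun i _ => analyticAt_const.mul ?_
    have h1 : AnalyticAt ℝ (fun t : ℝ => Complex.I * ((c i * t : ℝ) : ℂ)) t :=
      analyticAt_const.mul ((Complex.ofRealCLM.analyticAt _).comp
        (analyticAt_const.mul analyticAt_id))
    exact AnalyticAt.comp (g := Complex.exp) (analyticAt_cexp.restrictScalars (𝕜 := ℝ)) h1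
  have h := ae_restrict_le_codiscreteWithin (μ := (volume : Measure ℝ)) MeasurableSet.univ
    (han.preimage_zero_mem_codiscrete ht₀)
  rwa [Measure.restrict_univ] at h

/-- A nonzero trigonometric polynomial on a finite-dimensional space vanishes only on a null
set. -/
lemma ae_trigSum_ne_zero {E : Type*} [NormedAddCommGroup E] [NormedSpace ℝ E]
    [FiniteDimensional ℝ E] [MeasurableSpace E] [BorelSpace E] (ν : Measure E)
    [ν.IsAddHaarMeasure] {ι : Type*} [Fintype ι] {l : ι → Module.Dual ℝ E}
    (hl : Function.Injective l) {a : ι → ℂ} (ha : a ≠ 0) :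
    ∀ᵐ y ∂ν, ∑ i, a i * Complex.exp (Complex.I * ((l i y : ℝ) : ℂ)) ≠ 0 := by
  -- A direction outside the finitely many kernels of `l i - l j` keeps the frequencies distinct on
  -- every line parallel to `u`; Fubini along these lines reduces the claim to dimension one.
  obtain ⟨u, hu⟩ := Module.Dual.exists_forall_ne_zero_of_forall_exists
    (fun p : {p : ι × ι // p.1 ≠ p.2} => l p.1.1 - l p.1.2) fun p => by
      by_contra! h
      exact p.2 (hl (sub_eq_zero.1 (LinearMap.ext h)))
  have hinj : Function.Injective fun i => l i u := fun i j hij => by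
    by_contra hne
    exact hu ⟨(i, j), hne⟩ (by simpa [sub_eq_zero] using hij)
  have hcont : Continuous fun y : E => ∑ i, a i * Complex.exp (Complex.I * ((l i y : ℝ) : ℂ)) := by
    have := fun i => (l i).continuous_of_finiteDimensional
    fun_prop
  have : ProperSpace E := FiniteDimensional.proper_real E
  refine ae_mem_of_ae_add_linearMap_mem (LinearMap.toSpanSingleton ℝ E u) volume ν
    (isOpen_ne.preimage hcont).measurableSet fun y => ?_
  have ha' : (fun i => a i * Complex.exp (Complex.I * ((l i y : ℝ) : ℂ))) ≠ 0 := fun h0 =>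
    ha (funext fun i => by simpa using congrFun h0 i)
  filter_upwards [ae_trigSum_real_ne_zero hinj ha'] with t ht
  refine fun h => ht (Eq.trans (Finset.sum_congr rfl fun i _ => ?_) h)
  rw [mul_assoc, ← Complex.exp_add]
  congr 2
  simp
  ring

/-- Finite products of measures preserve absolute continuity. -/
lemma absolutelyContinuous_pi {α : Type*} [MeasurableSpace α] {μ ν : Measure α}
    [SigmaFinite μ] [SigmaFinite ν] (h : μ ≪ ν) :
    ∀ n : ℕ, Measure.pi (fun _ : Fin n => μ) ≪ Measure.pi fun _ : Fin n => ν
  | 0 => by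
    rw [Measure.pi_of_empty, Measure.pi_of_empty]
  | n + 1 => by
    have hμ := (measurePreserving_piFinSuccAbove (fun _ : Fin (n + 1) => μ) 0).symm
    have hν := (measurePreserving_piFinSuccAbove (fun _ : Fin (n + 1) => ν) 0).symm
    rw [← hμ.map_eq, ← hν.map_eq]
    exact (h.prod (absolutelyContinuous_pi h n)).map (MeasurableEquiv.measurable _)

/-- The Leibniz expansion shows a trigonometric polynomial in all the `w k` jointly, with one
frequency per permutation. -/
lemma det_featureMatrix {d m : ℕ} (x w : Fin m → Rd d) :
    (featureMatrix x w).det = ∑ σ : Equiv.Perm (Fin m), ((Equiv.Perm.sign σ : ℤ) : ℂ) *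
      Complex.exp (Complex.I * ((∑ k, inner ℝ (w k) (x (σ k)) : ℝ) : ℂ)) := by
  rw [Matrix.det_apply']
  refine Finset.sum_congr rfl fun σ _ => ?_
  simp [featureMatrix, feature, ← Complex.exp_sum, Finset.mul_sum]

/-- Square random feature matrices with distinct nodes are almost surely invertible. -/
lemma ae_det_featureMatrix_ne_zero {d m : ℕ} {x : Fin m → Rd d} (hx : Function.Injective x) :
    ∀ᵐ w : Fin m → Rd d, (featureMatrix x w).det ≠ 0 := by
  simp_rw [det_featureMatrix]
  have hl : Function.Injective fun σ : Equiv.Perm (Fin m) =>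
      ∑ k, (innerₗ (Rd d) (x (σ k))).comp
        (LinearMap.proj (R := ℝ) (φ := fun _ : Fin m => Rd d) k) := by
    -- Testing on vectors supported in the single slot `k` recovers `x (σ k)`, so distinct nodes
    -- give distinct frequencies.
    intro σ τ h
    ext k : 1
    refine hx (ext_inner_right ℝ fun v => ?_)
    have h1 := LinearMap.congr_fun h (Pi.single k v)
    simpa [Pi.single_apply, apply_ite, Finset.sum_ite_eq] using h1
  have ha : (fun σ : Equiv.Perm (Fin m) => ((Equiv.Perm.sign σ : ℤ) : ℂ)) ≠ 0 := fun h0 => by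
    have := congrFun h0 1
    simp at this
  filter_upwards [ae_trigSum_ne_zero volume hl ha] with w hw
  simpa [real_inner_comm] using hw

lemma cauchyDensity_pos {d : ℕ} {γ : ℝ} (hγ : 0 < γ) (w : Rd d) : 0 < cauchyDensity γ w :=
  Finset.prod_pos fun j _ => by have := Real.pi_pos; positivity

lemma measurable_cauchyDensity {d : ℕ} (γ : ℝ) :
    Measurable fun w : Rd d => cauchyDensity γ w := by
  unfold cauchyDensity
  fun_prop

lemma tensorCauchy_absolutelyContinuous (d : ℕ) (γ : ℝ) : tensorCauchy d γ ≪ volume :=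
  withDensity_absolutelyContinuous _ _

/-- With at least as many features as nodes, the interpolation problem is almost surely solvable
for all data. -/
lemma ae_exists_mulVec_eq {d m N : ℕ} {γ : ℝ} (hmN : m ≤ N) {x : Fin m → Rd d}
    (hx : Function.Injective x) {Ω : Type*} [MeasurableSpace Ω] {μ : Measure Ω}
    [IsProbabilityMeasure μ] {w : Fin N → Ω → Rd d} (hw : ∀ k, Measurable (w k))
    (hind : iIndepFun w μ) (hlaw : ∀ k, μ.map (w k) = tensorCauchy d γ) :
    ∀ᵐ s ∂μ, ∀ y : Fin m → ℂ, ∃ c : Fin N → ℂ,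
      (featureMatrix x fun k => w k s).mulVec c = y := by
  rcases Nat.eq_zero_or_pos m with rfl | hm
  · exact .of_forall fun s y => ⟨0, Subsingleton.elim _ _⟩
  have : IsProbabilityMeasure (tensorCauchy d γ) :=
    hlaw ⟨0, hm.trans_le hmN⟩ ▸ Measure.isProbabilityMeasure_map (hw _).aemeasurable
  -- The first `m` features suffice: their joint law is absolutely continuous, so their square block
  -- is almost surely invertible, and the other coefficients are set to zero.
  set e := Fin.castLE hmN with he
  have hmap := (iIndepFun_iff_map_fun_eq_pi_map fun k => (hw (e k)).aemeasurable).1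
    (hind.precomp (Fin.castLE_injective hmN))
  simp only [hlaw] at hmap
  have hae : ∀ᵐ v ∂(μ.map fun s k => w (e k) s), (featureMatrix x v).det ≠ 0 := by
    rw [hmap]
    exact (absolutelyContinuous_pi (tensorCauchy_absolutelyContinuous d γ) m).ae_le
      (ae_det_featureMatrix_ne_zero hx)
  filter_upwards [ae_of_ae_map (measurable_pi_lambda _ fun k => hw (e k)).aemeasurable hae]
    with s hs y
  set B := featureMatrix x fun k => w (e k) s with hB
  refine ⟨Function.extend e (B⁻¹.mulVec y) 0, ?_⟩
  have h1 : B.mulVec (B⁻¹.mulVec y) = y := by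
    rw [Matrix.mulVec_mulVec, Matrix.mul_nonsing_inv _ (isUnit_iff_ne_zero.2 hs),
      Matrix.one_mulVec]
  rw [← h1]
  ext j
  have hinj : Function.Injective e := Fin.castLE_injective hmN
  simp only [Matrix.mulVec, dotProduct]
  rw [← Finset.sum_subset (Finset.subset_univ (Finset.univ.map ⟨e, hinj⟩)), Finset.sum_map]
  · refine Finset.sum_congr rfl fun k _ => ?_
    simp only [Function.Embedding.coeFn_mk, hinj.extend_apply, h1]
    rfl
  · intro k _ hk
    rw [Function.extend_apply', Pi.zero_apply, mul_zero]
    rintro ⟨i, rfl⟩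
    exact hk (by simp)

/-- A solvable linear system has a solution of minimal norm. -/
lemma exists_isMinNormInterpolant {m N : ℕ} {A : Matrix (Fin m) (Fin N) ℂ} {y : Fin m → ℂ}
    (h : ∃ c, A.mulVec c = y) : ∃ c, IsMinNormInterpolant A y c := by
  obtain ⟨c₀, hc₀⟩ := h
  have hcont : Continuous fun c : EuclideanSpace ℂ (Fin N) => A.mulVec c.ofLp :=
    Continuous.matrix_mulVec continuous_const (PiLp.continuous_ofLp _ _)
  obtain ⟨c, hc, hd⟩ := (isClosed_singleton.preimage hcont).exists_infDist_eq_dist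
    (s := (fun c : EuclideanSpace ℂ (Fin N) => A.mulVec c.ofLp) ⁻¹' {y})
    ⟨WithLp.toLp 2 c₀, hc₀⟩ 0
  refine ⟨c, hc, fun c' hc' => ?_⟩
  rw [← dist_zero_left, ← hd, ← dist_zero_left]
  exact Metric.infDist_le_dist_of_mem hc'

end FullRank

/-! ### From values at the nodes to the norm of `L²(D)`. -/

section Sampling

/-- The unit ball of `ℝ^d` has volume at most `exp π`, in every dimension. -/
lemma volumeReal_ball_le (d : ℕ) : volume.real (Metric.ball (0 : Rd d) 1) ≤ Real.exp Real.pi := by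
  -- This Gaussian has mass one in every dimension and is at least `exp (-π)` on the unit ball.
  have h1 : ∫ v : Rd d, Real.exp (-Real.pi * ‖v‖ ^ 2) = 1 := by
    rw [GaussianFourier.integral_rexp_neg_mul_sq_norm Real.pi_pos, div_self Real.pi_ne_zero,
      Real.one_rpow]
  have hi : Integrable fun v : Rd d => Real.exp (-Real.pi * ‖v‖ ^ 2) := by
    by_contra h
    rw [integral_undef h] at h1
    exact zero_ne_one h1
  have h2 : volume.real (Metric.ball (0 : Rd d) 1) * Real.exp (-Real.pi) ≤ 1 := by
    calc _ = ∫ _ in Metric.ball (0 : Rd d) 1, Real.exp (-Real.pi) := by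
          rw [setIntegral_const, smul_eq_mul]
      _ ≤ ∫ v in Metric.ball (0 : Rd d) 1, Real.exp (-Real.pi * ‖v‖ ^ 2) := by
          refine setIntegral_mono_on (integrableOn_const measure_ball_lt_top.ne)
            hi.integrableOn measurableSet_ball fun v hv => Real.exp_le_exp.2 ?_
          have h3 : ‖v‖ ^ 2 ≤ 1 :=
            pow_le_one₀ (norm_nonneg _) (mem_ball_zero_iff.1 hv).le
          nlinarith [Real.pi_pos]
      _ ≤ ∫ v : Rd d, Real.exp (-Real.pi * ‖v‖ ^ 2) :=
          setIntegral_le_integral hi (.of_forall fun v => (Real.exp_pos _).le)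
      _ = 1 := h1
  rwa [Real.exp_neg, ← div_eq_mul_inv, div_le_one (Real.exp_pos _)] at h2

lemma fillDistance_nonneg {d m : ℕ} (D : Set (Rd d)) (x : Fin m → Rd d) :
    0 ≤ fillDistance D x :=
  Real.iSup_nonneg fun _ => Real.iInf_nonneg fun _ => norm_nonneg _

/-- Every point of a bounded domain lies within the fill distance of some node. -/
lemma exists_norm_sub_le_fillDistance {d m : ℕ} {D : Set (Rd d)} (hD : Bornology.IsBounded D)
    (hm : 1 ≤ m) (x : Fin m → Rd d) {y : Rd d} (hy : y ∈ D) :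
    ∃ j, ‖y - x j‖ ≤ fillDistance D x := by
  have : Nonempty (Fin m) := ⟨⟨0, hm⟩⟩
  obtain ⟨R, hR⟩ := hD.exists_norm_le
  obtain ⟨j, hj⟩ := exists_eq_ciInf_of_finite (f := fun j => ‖y - x j‖)
  refine ⟨j, hj.le.trans (le_ciSup (f := fun y : D => ⨅ j, ‖(y : Rd d) - x j‖) ?_ ⟨y, hy⟩)⟩
  -- An explicit upper bound is needed because the supremum of an unbounded real family is 0 by
  -- convention.
  refine ⟨R + ‖x ⟨0, hm⟩‖, ?_⟩
  rintro _ ⟨z, rfl⟩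
  refine (ciInf_le (Set.finite_range _).bddBelow ⟨0, hm⟩).trans ((norm_sub_le _ _).trans ?_)
  have := hR z z.2
  linarith

/-- The squared `L²(D)` norm of a Lipschitz function is controlled by its values at the nodes. -/
lemma l2Norm_sq_le {d m : ℕ} {D : Set (Rd d)} (hD : IsCompact D) (hm : 1 ≤ m)
    {x : Fin m → Rd d} (hx : ∀ j, x j ∈ D) {g : Rd d → ℂ} (hg : Continuous g) {L : ℝ}
    (hL : 0 ≤ L) (hlip : IsLipschitzOn D L g) :
    l2Norm D g ^ 2 ≤ 2 * L ^ 2 * fillDistance D x ^ 2 * volume.real D +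
      2 * Real.exp Real.pi * fillDistance D x ^ d * ∑ j, ‖g (x j)‖ ^ 2 := by
  set h := fillDistance D x with hh
  have h0 : 0 ≤ h := fillDistance_nonneg D x
  have hDfin : volume D ≠ ⊤ := hD.measure_lt_top.ne
  have hball : ∀ j, volume.real (Metric.closedBall (x j) h) ≤ h ^ d * Real.exp Real.pi := by
    intro j
    rw [measureReal_def, Measure.addHaar_closedBall _ _ h0, ENNReal.toReal_mul,
      ENNReal.toReal_ofReal (by positivity), finrank_euclideanSpace, Fintype.card_fin]
    exact mul_le_mul_of_nonneg_left (volumeReal_ball_le d) (by positivity)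
  -- A nearby node contributes one term of the sum; overlapping balls only enlarge the right side,
  -- so no partition of `D` is needed.
  have hpt : ∀ y ∈ D, ‖g y‖ ^ 2 ≤ 2 * L ^ 2 * h ^ 2 +
      ∑ j, (Metric.closedBall (x j) h).indicator (fun _ => 2 * ‖g (x j)‖ ^ 2) y := by
    intro y hy
    obtain ⟨j, hj⟩ := exists_norm_sub_le_fillDistance hD.isBounded hm x hy
    have h1 : 2 * ‖g (x j)‖ ^ 2 ≤
        ∑ j, (Metric.closedBall (x j) h).indicator (fun _ => 2 * ‖g (x j)‖ ^ 2) y := by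
      refine le_trans ?_ (Finset.single_le_sum (f := fun j =>
        (Metric.closedBall (x j) h).indicator (fun _ => 2 * ‖g (x j)‖ ^ 2) y)
        (fun i _ => Set.indicator_nonneg (fun _ _ => by positivity) _) (Finset.mem_univ j))
      rw [Set.indicator_of_mem (by rwa [mem_closedBall_iff_norm])]
    have h2 : ‖g y - g (x j)‖ ≤ L * h :=
      (hlip y hy _ (hx j)).trans (mul_le_mul_of_nonneg_left hj hL)
    have h3 : ‖g y‖ ≤ L * h + ‖g (x j)‖ := by
      have := norm_add_le (g y - g (x j)) (g (x j))
      rw [sub_add_cancel] at this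
      linarith
    have h4 : ‖g y‖ ^ 2 ≤ (L * h + ‖g (x j)‖) ^ 2 := pow_le_pow_left₀ (norm_nonneg _) h3 2
    nlinarith [sq_nonneg (L * h - ‖g (x j)‖)]
  have hconst : Integrable (fun _ : Rd d => 2 * L ^ 2 * h ^ 2) (volume.restrict D) :=
    integrableOn_const hDfin
  have hind : ∀ j ∈ Finset.univ, Integrable (fun y => (Metric.closedBall (x j) h).indicator
      (fun _ => 2 * ‖g (x j)‖ ^ 2) y) (volume.restrict D) := fun j _ =>
    (integrableOn_const (s := D) (C := 2 * ‖g (x j)‖ ^ 2) hDfin).integrable.indicator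
      measurableSet_closedBall
  have hsum : IntegrableOn (fun y => 2 * L ^ 2 * h ^ 2 + ∑ j,
      (Metric.closedBall (x j) h).indicator (fun _ => 2 * ‖g (x j)‖ ^ 2) y) D :=
    hconst.add (integrable_finsetSum _ hind)
  have hint : ∀ j, ∫ y in D, (Metric.closedBall (x j) h).indicator
      (fun _ => 2 * ‖g (x j)‖ ^ 2) y ≤ h ^ d * Real.exp Real.pi * (2 * ‖g (x j)‖ ^ 2) := by
    intro j
    rw [setIntegral_indicator measurableSet_closedBall, setIntegral_const, smul_eq_mul]
    refine mul_le_mul_of_nonneg_right ((measureReal_mono Set.inter_subset_right ?_).trans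
      (hball j)) (by positivity)
    exact measure_closedBall_lt_top.ne
  rw [l2Norm, Real.sq_sqrt (integral_nonneg fun _ => by positivity)]
  calc ∫ y in D, ‖g y‖ ^ 2
      ≤ ∫ y in D, (2 * L ^ 2 * h ^ 2 + ∑ j,
          (Metric.closedBall (x j) h).indicator (fun _ => 2 * ‖g (x j)‖ ^ 2) y) :=
        setIntegral_mono_on ((hg.norm.pow 2).continuousOn.integrableOn_compact hD)
          hsum
          hD.measurableSet hpt
    _ = 2 * L ^ 2 * h ^ 2 * volume.real D + ∑ j, ∫ y in D,
          (Metric.closedBall (x j) h).indicator (fun _ => 2 * ‖g (x j)‖ ^ 2) y := by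
        rw [integral_add hconst (integrable_finsetSum _ hind),
          integral_finsetSum _ hind, setIntegral_const, smul_eq_mul, mul_comm (volume.real D)]
    _ ≤ 2 * L ^ 2 * h ^ 2 * volume.real D +
          ∑ j, h ^ d * Real.exp Real.pi * (2 * ‖g (x j)‖ ^ 2) := by
        gcongr with j
        exact hint j
    _ = _ := by
        rw [← Finset.mul_sum, ← Finset.mul_sum]; ring

end Sampling

/-! ### The error of `f^*` at the nodes: truncation bias and random fluctuation. -/

section Approximation

variable {d m N : ℕ} {γ T : ℝ} {f fhat : Rd d → ℂ}

lemma norm_feature (w x : Rd d) : ‖feature w x‖ = 1 := by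
  rw [feature, mul_comm, Complex.norm_exp_ofReal_mul_I]

lemma continuous_feature_left (x : Rd d) : Continuous fun w => feature w x := by
  unfold feature; fun_prop

lemma continuous_feature_right (w : Rd d) : Continuous fun x => feature w x := by
  unfold feature; fun_prop

lemma measurable_alpha (hf : Measurable fhat) : Measurable (alpha γ fhat) :=
  hf.div (Complex.measurable_ofReal.comp (measurable_cauchyDensity γ))

lemma measurable_alphaTrunc (hf : Measurable fhat) : Measurable (alphaTrunc γ fhat T) :=
  Measurable.ite (measurableSet_le (measurable_alpha hf).norm measurable_const)
    (measurable_alpha hf) measurable_const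

lemma norm_alphaTrunc_le (hT : 0 ≤ T) (w : Rd d) : ‖alphaTrunc γ fhat T w‖ ≤ T := by
  unfold alphaTrunc; split_ifs with h <;> simp [h, hT]

lemma norm_alphaTrunc_le_norm_alpha (w : Rd d) :
    ‖alphaTrunc γ fhat T w‖ ≤ ‖alpha γ fhat w‖ := by
  unfold alphaTrunc; split_ifs with h <;> simp

/-- The difference is nonzero only where `‖α‖ > T`, and there `‖α‖ ≤ ‖α‖² / T`. -/
lemma norm_alphaTrunc_sub_alpha_le (hT : 0 < T) (w : Rd d) :
    ‖alphaTrunc γ fhat T w - alpha γ fhat w‖ ≤ ‖alpha γ fhat w‖ ^ 2 / T := by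
  unfold alphaTrunc
  split_ifs with h
  · simp; positivity
  · rw [zero_sub, norm_neg, le_div_iff₀ hT, sq]
    exact mul_le_mul_of_nonneg_left (not_le.1 h).le (norm_nonneg _)

lemma integral_tensorCauchy (hγ : 0 < γ) (g : Rd d → ℂ) :
    ∫ w, g w ∂tensorCauchy d γ = ∫ w, (cauchyDensity γ w : ℂ) * g w := by
  rw [tensorCauchy, integral_withDensity_eq_integral_toReal_smul
    (measurable_cauchyDensity γ).ennreal_ofReal (by simp)]
  simp [ENNReal.toReal_ofReal (cauchyDensity_pos hγ _).le]

lemma MemF.eq_integral_alpha (hγ : 0 < γ) (hf : MemF γ f fhat) (x : Rd d) :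
    f x = ∫ w, alpha γ fhat w * feature w x ∂tensorCauchy d γ := by
  rw [hf.eq_integral, integral_tensorCauchy hγ]
  congr with w
  rw [alpha, ← mul_assoc, mul_div_cancel₀ _ (by exact_mod_cast (cauchyDensity_pos hγ w).ne')]

lemma rhoNorm_sq : rhoNorm γ fhat ^ 2 = ∫ w, ‖alpha γ fhat w‖ ^ 2 ∂tensorCauchy d γ :=
  Real.sq_sqrt (integral_nonneg fun _ => by positivity)

/-- The truncated contribution `α_{≤ T}(w) (exp(i ⟨w, x_j⟩))_j` of a feature to the values at the
nodes. -/
noncomputable def nodeVec (γ : ℝ) (fhat : Rd d → ℂ) (T : ℝ) (x : Fin m → Rd d) (w : Rd d) :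
    EuclideanSpace ℂ (Fin m) :=
  WithLp.toLp 2 fun j => alphaTrunc γ fhat T w * feature w (x j)

lemma measurable_nodeVec (hf : Measurable fhat) (x : Fin m → Rd d) :
    Measurable (nodeVec γ fhat T x) :=
  (WithLp.measurable_toLp 2 _).comp (measurable_pi_lambda _ fun j =>
    (measurable_alphaTrunc hf).mul (continuous_feature_left (x j)).measurable)

lemma norm_nodeVec_sq (x : Fin m → Rd d) (w : Rd d) :
    ‖nodeVec γ fhat T x w‖ ^ 2 = m * ‖alphaTrunc γ fhat T w‖ ^ 2 := by
  simp [EuclideanSpace.norm_sq_eq, nodeVec, norm_feature]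

lemma norm_nodeVec_le (hT : 0 ≤ T) (x : Fin m → Rd d) (w : Rd d) :
    ‖nodeVec γ fhat T x w‖ ≤ T * √m := by
  refine (sq_le_sq₀ (norm_nonneg _) (by positivity)).1 ?_
  rw [norm_nodeVec_sq, mul_pow, Real.sq_sqrt (Nat.cast_nonneg _), mul_comm]
  exact mul_le_mul_of_nonneg_right
    (pow_le_pow_left₀ (norm_nonneg _) (norm_alphaTrunc_le hT w) 2) (Nat.cast_nonneg _)

lemma integrable_nodeVec [IsProbabilityMeasure (tensorCauchy d γ)] (hT : 0 ≤ T)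
    (hf : Measurable fhat) (x : Fin m → Rd d) :
    Integrable (nodeVec γ fhat T x) (tensorCauchy d γ) :=
  .of_bound (measurable_nodeVec hf x).aestronglyMeasurable _ (.of_forall (norm_nodeVec_le hT x))

lemma integrable_alpha [IsProbabilityMeasure (tensorCauchy d γ)] (hm : Measurable fhat)
    (hf : MemF γ f fhat) : Integrable (alpha γ fhat) (tensorCauchy d γ) := by
  refine ((integrable_const (1 : ℝ)).add hf.finite_norm).mono'
    (measurable_alpha hm).aestronglyMeasurable (.of_forall fun w => ?_)
  simp only [Pi.add_apply]
  nlinarith [sq_nonneg (‖alpha γ fhat w‖ - 1), norm_nonneg (alpha γ fhat w)]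

/-- The bias caused by the truncation. -/
lemma norm_integral_nodeVec_sub_le [IsProbabilityMeasure (tensorCauchy d γ)] (hγ : 0 < γ)
    (hT : 0 < T) (hm : Measurable fhat) (hf : MemF γ f fhat) (x : Fin m → Rd d) (j : Fin m) :
    ‖(∫ w, nodeVec γ fhat T x w ∂tensorCauchy d γ) j - f (x j)‖ ≤ rhoNorm γ fhat ^ 2 / T := by
  have hi := integrable_nodeVec (γ := γ) hT.le hm x
  have h1 : (∫ w, nodeVec γ fhat T x w ∂tensorCauchy d γ) j =
      ∫ w, alphaTrunc γ fhat T w * feature w (x j) ∂tensorCauchy d γ :=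
    ((EuclideanSpace.proj (𝕜 := ℂ) j).integral_comp_comm hi).symm
  have h2 : Integrable (fun w => alphaTrunc γ fhat T w * feature w (x j)) (tensorCauchy d γ) :=
    (EuclideanSpace.proj (𝕜 := ℂ) j).integrable_comp hi
  have h3 : Integrable (fun w => alpha γ fhat w * feature w (x j)) (tensorCauchy d γ) :=
    (integrable_alpha hm hf).mono
      ((measurable_alpha hm).mul (continuous_feature_left _).measurable).aestronglyMeasurable
      (.of_forall fun w => by simp [norm_feature])
  rw [h1, hf.eq_integral_alpha hγ, ← integral_sub h2 h3, rhoNorm_sq, ← integral_div]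
  refine norm_integral_le_of_norm_le (hf.finite_norm.div_const T) (.of_forall fun w => ?_)
  rw [← sub_mul, norm_mul, norm_feature, mul_one]
  exact norm_alphaTrunc_sub_alpha_le hT w

/-- The two sides differ by the squared norm of the mean. -/
lemma integral_norm_sub_integral_sq_le {E α : Type*} [MeasurableSpace α] {ν : Measure α}
    [IsProbabilityMeasure ν] [NormedAddCommGroup E] [InnerProductSpace ℝ E] [CompleteSpace E]
    {Z : α → E} (hZ : Integrable Z ν) (hZ2 : Integrable (fun w => ‖Z w‖ ^ 2) ν) :
    ∫ w, ‖Z w - ∫ w, Z w ∂ν‖ ^ 2 ∂ν ≤ ∫ w, ‖Z w‖ ^ 2 ∂ν := by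
  set e := ∫ w, Z w ∂ν with he
  have hin : Integrable (fun w => 2 * inner ℝ (Z w) e) ν := (hZ.inner_const e).const_mul 2
  have h2 : ∫ w, inner ℝ (Z w) e ∂ν = ‖e‖ ^ 2 := by
    rw [integral_congr_ae (.of_forall fun w => real_inner_comm e (Z w)), integral_inner hZ, ← he,
      real_inner_self_eq_norm_sq]
  have hsub : Integrable (fun w => ‖Z w‖ ^ 2 - 2 * inner ℝ (Z w) e) ν := hZ2.sub hin
  simp_rw [norm_sub_sq_real]
  rw [integral_add hsub (integrable_const _), integral_sub hZ2 hin, integral_const_mul,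
    h2]
  simp
  nlinarith [sq_nonneg ‖e‖]

lemma integral_norm_nodeVec_sq_le [IsProbabilityMeasure (tensorCauchy d γ)] (hT : 0 ≤ T)
    (hm : Measurable fhat) (hf : MemF γ f fhat) (x : Fin m → Rd d) :
    Integrable (fun w => ‖nodeVec γ fhat T x w‖ ^ 2) (tensorCauchy d γ) ∧
    ∫ w, ‖nodeVec γ fhat T x w‖ ^ 2 ∂tensorCauchy d γ ≤ m * rhoNorm γ fhat ^ 2 := by
  have hi : Integrable (fun w => ‖nodeVec γ fhat T x w‖ ^ 2) (tensorCauchy d γ) :=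
    .of_bound ((measurable_nodeVec hm x).norm.pow_const 2).aestronglyMeasurable ((T * √m) ^ 2)
      (.of_forall fun w => by
        rw [Real.norm_of_nonneg (by positivity)]
        exact pow_le_pow_left₀ (norm_nonneg _) (norm_nodeVec_le hT x w) 2)
  refine ⟨hi, ?_⟩
  rw [rhoNorm_sq, ← integral_const_mul]
  refine integral_mono hi (hf.finite_norm.const_mul _) fun w => ?_
  simp only [norm_nodeVec_sq]
  exact mul_le_mul_of_nonneg_left
    (pow_le_pow_left₀ (norm_nonneg _) (norm_alphaTrunc_le_norm_alpha w) 2) (Nat.cast_nonneg _)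

/-- With `e` the mean of `nodeVec`, this splits the error into a centred fluctuation and the
truncation bias; the identity itself holds for any `e`. -/
lemma fStar_sub_eq (hN : 0 < N) (x : Fin m → Rd d) (w : Fin N → Rd d)
    (e : EuclideanSpace ℂ (Fin m)) (j : Fin m) :
    fStar γ fhat T w (x j) - f (x j) =
      (1 / (N : ℂ)) * (∑ k, (nodeVec γ fhat T x (w k) - e)) j + (e j - f (x j)) := by
  have hN' : (N : ℂ) ≠ 0 := by exact_mod_cast hN.ne'
  have h : (∑ k, (nodeVec γ fhat T x (w k) - e)) j =
      ∑ k, alphaTrunc γ fhat T (w k) * feature (w k) (x j) - N * e j := by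
    simp [nodeVec, Finset.sum_sub_distrib]
  rw [h, fStar]
  field_simp
  ring

variable {Ω : Type*} [MeasurableSpace Ω] {μ : Measure Ω} [IsProbabilityMeasure μ]

/-- The best random feature model approximates the target at the nodes, for a measurable Fourier
transform. -/
lemma measureReal_sum_fStar_sub_sq_gt_le_of_measurable (hγ : 0 < γ) (hf : MemF γ f fhat)
    (hmeas : Measurable fhat) (hT : 0 < T) (hm : 0 < m) (hN : 0 < N) (x : Fin m → Rd d)
    {δ : ℝ} (hδ : 0 < δ) (hδ1 : δ < 2) {w : Fin N → Ω → Rd d} (hw : ∀ k, Measurable (w k))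
    (hind : iIndepFun w μ) (hlaw : ∀ k, μ.map (w k) = tensorCauchy d γ) :
    μ.real {s | 4 * m * I1 (rhoNorm γ fhat) T δ N <
      ∑ j, ‖fStar γ fhat T (fun k => w k s) (x j) - f (x j)‖ ^ 2} ≤ δ := by
  have : IsProbabilityMeasure (tensorCauchy d γ) :=
    hlaw ⟨0, hN⟩ ▸ Measure.isProbabilityMeasure_map (hw _).aemeasurable
  set e : EuclideanSpace ℂ (Fin m) := ∫ v, nodeVec γ fhat T x v ∂tensorCauchy d γ with he
  set L := Real.log (2 / δ) with hL
  have hL0 : 0 < L := Real.log_pos (by rw [lt_div_iff₀ hδ]; linarith)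
  have hm' : (0 : ℝ) < m := by exact_mod_cast hm
  have hN' : (0 : ℝ) < N := by exact_mod_cast hN
  set R := rhoNorm γ fhat with hR
  set Y : Rd d → EuclideanSpace ℂ (Fin m) := fun v => nodeVec γ fhat T x v - e with hY
  have hYm : Measurable Y := (measurable_nodeVec hmeas x).sub_const e
  have hZi := integrable_nodeVec (γ := γ) hT.le hmeas x
  obtain ⟨hZ2i, hZ2⟩ := integral_norm_nodeVec_sq_le (γ := γ) hT.le hmeas hf x
  have hen : ‖e‖ ≤ T * √m := by
    have := norm_integral_le_of_norm_le_const (μ := tensorCauchy d γ)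
      (.of_forall (norm_nodeVec_le (γ := γ) (fhat := fhat) hT.le x))
    simpa using this
  have hYb : ∀ v, ‖Y v‖ ≤ 2 * (T * √m) := fun v =>
    (norm_sub_le _ _).trans (by linarith [norm_nodeVec_le (γ := γ) (fhat := fhat) hT.le x v])
  have hmean : ∀ k, ∫ s, Y (w k s) ∂μ = 0 := fun k => by
    rw [← integral_map (hw k).aemeasurable hYm.aestronglyMeasurable, hlaw k,
      integral_sub hZi (integrable_const _)]
    simp [he]
  have hvar : ∀ k, ∫ s, ‖Y (w k s)‖ ^ 2 ∂μ ≤ m * R ^ 2 := fun k => by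
    rw [← integral_map (f := fun v => ‖Y v‖ ^ 2) (hw k).aemeasurable
      (hYm.norm.pow_const 2).aestronglyMeasurable, hlaw k]
    exact (integral_norm_sub_integral_sq_le hZi hZ2i).trans hZ2
  have hB := measureReal_norm_sum_ge_le_two_mul_exp (X := fun k s => Y (w k s)) (μ := μ)
    (fun k => hYm.comp (hw k)) (hind.comp (fun _ => Y) fun _ => hYm)
    (M := 2 * (T * √m)) (by positivity) (fun k s => hYb _) hmean hvar (by positivity) hL0
  rw [show 2 * Real.exp (-L) = δ by
    rw [hL, Real.exp_neg, Real.exp_log (by positivity)]; field_simp, Fintype.card_fin] at hB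
  refine (measureReal_mono fun s hs => ?_).trans hB
  rw [Set.mem_ofPred_eq] at hs ⊢
  by_contra! hlt
  refine hs.not_ge ?_
  set S := ∑ k, Y (w k s) with hS
  -- Bernstein's threshold with `M = 2 T √m` and variance `m R²`, squared through `(p + q)² ≤ 2p² +
  -- 2q²`.
  have hS2 : ‖S‖ ^ 2 ≤ 32 * T ^ 2 * m * L ^ 2 + 8 * (L * (N * (m * R ^ 2))) := by
    have h1 : √(m : ℝ) ^ 2 = m := Real.sq_sqrt hm'.le
    have h2 : √(L * (N * (m * R ^ 2))) ^ 2 = L * (N * (m * R ^ 2)) :=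
      Real.sq_sqrt (by positivity)
    set a := √(m : ℝ)
    set b := √(L * (N * (m * R ^ 2)))
    calc ‖S‖ ^ 2 ≤ (2 * (2 * (T * a)) * L + 2 * b) ^ 2 :=
          pow_le_pow_left₀ (norm_nonneg _) hlt.le 2
      _ ≤ 32 * T ^ 2 * a ^ 2 * L ^ 2 + 8 * b ^ 2 := by
          nlinarith [sq_nonneg (2 * (2 * (T * a)) * L - 2 * b)]
      _ = _ := by rw [h1, h2]
  have hpt : ∀ j, ‖fStar γ fhat T (fun k => w k s) (x j) - f (x j)‖ ^ 2 ≤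
      2 / N ^ 2 * ‖S j‖ ^ 2 + 2 * (R ^ 2 / T) ^ 2 := fun j => by
    rw [fStar_sub_eq hN x _ e j]
    have h1 := norm_add_le ((1 / (N : ℂ)) * S j) (e j - f (x j))
    rw [norm_mul, norm_div, norm_one, Complex.norm_natCast] at h1
    have h2 : ‖e j - f (x j)‖ ≤ R ^ 2 / T := norm_integral_nodeVec_sub_le hγ hT hmeas hf x j
    calc _ ≤ (1 / N * ‖S j‖ + R ^ 2 / T) ^ 2 :=
          pow_le_pow_left₀ (norm_nonneg _) (h1.trans (by linarith)) 2
      _ ≤ 2 * (1 / N * ‖S j‖) ^ 2 + 2 * (R ^ 2 / T) ^ 2 := by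
          nlinarith [sq_nonneg (1 / N * ‖S j‖ - R ^ 2 / T)]
      _ = _ := by ring
  calc _ ≤ ∑ j, (2 / (N : ℝ) ^ 2 * ‖S j‖ ^ 2 + 2 * (R ^ 2 / T) ^ 2) :=
        Finset.sum_le_sum fun j _ => hpt j
    _ = 2 / (N : ℝ) ^ 2 * ‖S‖ ^ 2 + m * (2 * (R ^ 2 / T) ^ 2) := by
        rw [Finset.sum_add_distrib, ← Finset.mul_sum, ← EuclideanSpace.norm_sq_eq]
        simp
    _ ≤ 2 / (N : ℝ) ^ 2 * (32 * T ^ 2 * m * L ^ 2 + 8 * (L * (N * (m * R ^ 2)))) +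
          m * (2 * (R ^ 2 / T) ^ 2) := by gcongr
    _ = m * (2 * R ^ 4 / T ^ 2 + 64 * T ^ 2 * L ^ 2 / N ^ 2 + 16 * R ^ 2 * L / N) := by
        field_simp
        ring
    -- The three terms exceed those of `I1` by the factors 1, 2 and 4, whence the 4 in `4 m I₁`.
    _ ≤ m * (4 * (2 * R ^ 4 / T ^ 2 + 32 * T ^ 2 * L ^ 2 / N ^ 2 + 4 * R ^ 2 * L / N)) := by
        refine mul_le_mul_of_nonneg_left ?_ hm'.le
        have h1 : 0 ≤ R ^ 4 / T ^ 2 := by positivity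
        have h2 : 0 ≤ T ^ 2 * L ^ 2 / N ^ 2 := by positivity
        have e1 : 2 * R ^ 4 / T ^ 2 = 2 * (R ^ 4 / T ^ 2) := by ring
        have e2 : 64 * T ^ 2 * L ^ 2 / N ^ 2 = 64 * (T ^ 2 * L ^ 2 / N ^ 2) := by ring
        have e3 : 32 * T ^ 2 * L ^ 2 / N ^ 2 = 32 * (T ^ 2 * L ^ 2 / N ^ 2) := by ring
        have e4 : 16 * R ^ 2 * L / N = 4 * (4 * R ^ 2 * L / N) := by ring
        rw [e1, e2, e3, e4]
        linarith
    _ = 4 * m * I1 R T δ N := by rw [I1]; ring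

/-- The best random feature model approximates the target at the nodes. -/
lemma measureReal_sum_fStar_sub_sq_gt_le (hγ : 0 < γ) (hf : MemF γ f fhat)
    (hT : 0 < T) (hm : 0 < m) (hN : 0 < N) (x : Fin m → Rd d)
    {δ : ℝ} (hδ : 0 < δ) (hδ1 : δ < 2) {w : Fin N → Ω → Rd d} (hw : ∀ k, Measurable (w k))
    (hind : iIndepFun w μ) (hlaw : ∀ k, μ.map (w k) = tensorCauchy d γ) :
    μ.real {s | 4 * m * I1 (rhoNorm γ fhat) T δ N <
      ∑ j, ‖fStar γ fhat T (fun k => w k s) (x j) - f (x j)‖ ^ 2} ≤ δ := by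
  -- The law of each `w k` is absolutely continuous, so replacing `fhat` by a measurable
  -- representative changes `fStar` only on a null event.
  set g := hf.aestronglyMeasurable.mk fhat with hg
  have hgm : Measurable g := hf.aestronglyMeasurable.stronglyMeasurable_mk.measurable
  have hae : fhat =ᵐ[volume] g := hf.aestronglyMeasurable.ae_eq_mk
  have hα : alpha γ fhat =ᵐ[tensorCauchy d γ] alpha γ g := by
    filter_upwards [(tensorCauchy_absolutelyContinuous d γ).ae_le hae] with v hv
    rw [alpha, alpha, hv]
  have hα2 : (fun v => ‖alpha γ fhat v‖ ^ 2) =ᵐ[tensorCauchy d γ] fun v => ‖alpha γ g v‖ ^ 2 :=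
    hα.mono fun v hv => by simp only [hv]
  have hgf : MemF γ f g :=
    ⟨hgm.aestronglyMeasurable, fun y => (hf.eq_integral y).trans (integral_congr_ae
      (hae.mono fun v hv => by simp only [hv])), hf.finite_norm.congr hα2⟩
  have hR : rhoNorm γ fhat = rhoNorm γ g := by rw [rhoNorm, rhoNorm, integral_congr_ae hα2]
  have hs : ∀ᵐ s ∂μ, ∀ k, alpha γ fhat (w k s) = alpha γ g (w k s) :=
    ae_all_iff.2 fun k => ae_of_ae_map (hw k).aemeasurable (by rw [hlaw k]; exact hα)
  refine le_of_eq_of_le (measureReal_congr (Filter.eventuallyEq_set.2 ?_))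
    (measureReal_sum_fStar_sub_sq_gt_le_of_measurable hγ hgf hgm hT hm hN x hδ hδ1 hw hind hlaw)
  filter_upwards [hs] with s hs
  have : ∀ y, fStar γ fhat T (fun k => w k s) y = fStar γ g T (fun k => w k s) y := fun y => by
    simp only [fStar, alphaTrunc, hs]
  simp only [this, hR]

lemma continuous_fStar_sub_rfModel (w : Fin N → Rd d) (c : EuclideanSpace ℂ (Fin N)) :
    Continuous fun y => fStar γ fhat T w y - rfModel w c y := by
  have := fun k => continuous_feature_right (w k)
  unfold fStar rfModel
  fun_prop

lemma rfModel_eq_mulVec (x : Fin m → Rd d) (w : Fin N → Rd d) (c : EuclideanSpace ℂ (Fin N))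
    (j : Fin m) : rfModel w c (x j) = (featureMatrix x w).mulVec c.ofLp j := by
  simp [rfModel, featureMatrix, Matrix.mulVec, dotProduct, mul_comm]

/-- The failure set need not be measurable; the event is the complement of its measurable hull. -/
lemma withProbAtLeast_of_measureReal_le {P : Ω → Prop} {q : ℝ} (h : μ.real {s | ¬P s} ≤ q) :
    WithProbAtLeast μ (1 - q) P := by
  refine ⟨(toMeasurable μ {s | ¬P s})ᶜ, (measurableSet_toMeasurable _ _).compl, ?_, fun s hs => ?_⟩
  · rw [prob_compl_eq_one_sub (measurableSet_toMeasurable _ _), measure_toMeasurable,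
      ENNReal.ofReal_sub _ (measureReal_nonneg.trans h), ENNReal.ofReal_one]
    refine tsub_le_tsub_left ?_ _
    rw [← ofReal_measureReal]
    exact ENNReal.ofReal_le_ofReal h
  · by_contra hP
    exact hs (subset_toMeasurable _ _ hP)

end Approximation

end CauchyRF

open MeasureTheory ProbabilityTheory CauchyRF
theorem theorem3p4 :
    ∃ C : ℝ, 0 < C ∧
      ∀ (d : ℕ), 1 ≤ d →
      ∀ (D : Set (Rd d)), IsCompact D →
      -- the data
      ∀ (m : ℕ), 1 ≤ m → ∀ (x : Fin m → Rd d), (∀ j, x j ∈ D) →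
      ∀ (K : ℝ), 0 < K → (∀ j j', j ≠ j' → K ≤ ‖x j - x j'‖) →
      -- the target function, its Fourier transform and the truncation level
      ∀ (γ : ℝ), 0 < γ → ∀ (f fhat : Rd d → ℂ), MemF γ f fhat →
      ∀ (T : ℝ), 0 < T →
      ∀ (N : ℕ) (η δ : ℝ), 0 < η → η < 1 / 2 → 0 < δ →
        C * (η ^ 2)⁻¹ * (m : ℝ) * Real.log ((m : ℝ) / (2 * δ)) ≤ (N : ℝ) →
        1 / K * Real.log ((m : ℝ) / η) ≤ γ →
      -- the i.i.d. random features
      ∀ (Ω : Type*) [MeasurableSpace Ω] (μ : Measure Ω) [IsProbabilityMeasure μ]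
        (w : Fin N → Ω → Rd d), (∀ k, Measurable (w k)) → iIndepFun w μ →
        (∀ k, μ.map (w k) = tensorCauchy d γ) →
      WithProbAtLeast μ (1 - 4 * δ) fun s =>
        -- the min-norm interpolation problem has a solution, and every solution obeys the bound
        (∃ c, IsMinNormInterpolant (featureMatrix x fun k => w k s) (fun j => f (x j)) c) ∧
        ∀ c, IsMinNormInterpolant (featureMatrix x fun k => w k s) (fun j => f (x j)) c →
        ∀ (L : ℝ), 0 < L →
          IsLipschitzOn D L
            (fun y => fStar γ fhat T (fun k => w k s) y - rfModel (fun k => w k s) c y) →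
          l2Norm D
              (fun y => fStar γ fhat T (fun k => w k s) y - rfModel (fun k => w k s) c y) ^ 2 ≤
            2 * L ^ 2 * fillDistance D x ^ 2 * volume.real D +
              C * fillDistance D x ^ d * (1 + 2 * η) *
                (2 * (m : ℝ) / (1 - 2 * η) * I1 (rhoNorm γ fhat) T δ N +
                  2 * I2 (rhoNorm γ fhat) T δ N) := by
  -- The factor `2 exp π` of `l2Norm_sq_le` times `4 m I₁` equals `4 exp π` times `2 m I₁`.
  refine ⟨4 * Real.exp Real.pi, by positivity, ?_⟩
  intro d _ D hD m hm x hxD K hK hsep γ hγ f fhat hf T hT N η δ hη hη2 hδ hN _ Ω _ μ _ w hw hind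
    hlaw
  -- Here `1 - 4δ ≤ 0` and the empty event suffices.
  by_cases hδ4 : 1 / 4 ≤ δ
  · exact ⟨∅, .empty, by rw [ENNReal.ofReal_of_nonpos (by linarith)]; exact zero_le,
      fun s hs => hs.elim⟩
  push Not at hδ4
  have hm1 : (1 : ℝ) ≤ m := by exact_mod_cast hm
  -- As `δ < 1/4` and `m ≥ 1`, the logarithm is at least `log 2 > 1/2`; the factor 4 of the constant
  -- absorbs this.
  have hmN : m ≤ N := by
    have h1 : (1 : ℝ) ≤ Real.exp Real.pi := Real.one_le_exp Real.pi_pos.le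
    have h2 : (1 : ℝ) ≤ (η ^ 2)⁻¹ := (one_le_inv₀ (by positivity)).2 (by nlinarith)
    have h3 : 1 / 2 ≤ Real.log ((m : ℝ) / (2 * δ)) := by
      have h4 : Real.log 2 ≤ Real.log ((m : ℝ) / (2 * δ)) :=
        Real.log_le_log two_pos (by rw [le_div_iff₀ (by positivity)]; linarith)
      linarith [Real.log_two_gt_d9]
    have h5 : (m : ℝ) ≤ N := by
      refine le_trans ?_ hN
      calc (m : ℝ) ≤ 4 * 1 * 1 * m * (1 / 2) := by linarith
        _ ≤ 4 * Real.exp Real.pi * (η ^ 2)⁻¹ * m * Real.log ((m : ℝ) / (2 * δ)) := by gcongr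
    exact_mod_cast h5
  have hinj : Function.Injective x := fun i j hij => by
    by_contra hne
    have := hsep i j hne
    rw [hij, sub_self, norm_zero] at this
    linarith
  refine withProbAtLeast_of_measureReal_le (le_trans ?_ (by linarith : δ ≤ 4 * δ))
  refine le_trans ?_ (measureReal_sum_fStar_sub_sq_gt_le hγ hf hT hm (hm.trans hmN) x hδ
    (by linarith) hw hind hlaw)
  -- Outside the null set of unsolvable systems, failure of the claim forces a large error of `f^*`
  -- at the nodes, so one event of probability `δ` is all that is lost.
  refine ENNReal.toReal_mono (measure_ne_top _ _) (measure_mono_ae ?_)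
  filter_upwards [ae_exists_mulVec_eq hmN hinj hw hind hlaw] with s hs hbad
  by_contra hgood
  refine hbad ⟨exists_isMinNormInterpolant (hs _), fun c hc L hL hlip => ?_⟩
  have hsum : ∑ j, ‖fStar γ fhat T (fun k => w k s) (x j) - rfModel (fun k => w k s) c (x j)‖ ^ 2 ≤
      4 * m * I1 (rhoNorm γ fhat) T δ N := by
    simp only [rfModel_eq_mulVec, hc.1]
    exact not_lt.1 hgood
  refine (l2Norm_sq_le hD hm hxD (continuous_fStar_sub_rfModel _ c) hL.le hlip).trans ?_
  have hlog : 0 ≤ Real.log (2 / δ) :=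
    Real.log_nonneg (by rw [le_div_iff₀ hδ]; linarith)
  set R := rhoNorm γ fhat
  have hI1 : 0 ≤ I1 R T δ N := by unfold I1; positivity
  have hI2 : 0 ≤ I2 R T δ N := by unfold I2; positivity
  have hh : 0 ≤ fillDistance D x ^ d := pow_nonneg (fillDistance_nonneg D x) d
  have hfrac : 2 * (m : ℝ) ≤ 2 * m / (1 - 2 * η) := by
    rw [le_div_iff₀ (by linarith)]; nlinarith
  have hbr : 2 * m * I1 R T δ N ≤
      (1 + 2 * η) * (2 * (m : ℝ) / (1 - 2 * η) * I1 R T δ N + 2 * I2 R T δ N) := by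
    have h1 := mul_le_mul_of_nonneg_right hfrac hI1
    have h2 : 0 ≤ 2 * m * I1 R T δ N := by positivity
    nlinarith
  refine add_le_add le_rfl ?_
  calc _ ≤ 2 * Real.exp Real.pi * fillDistance D x ^ d * (4 * m * I1 R T δ N) := by gcongr
    _ = 4 * Real.exp Real.pi * fillDistance D x ^ d * (2 * m * I1 R T δ N) := by ring
    _ ≤ 4 * Real.exp Real.pi * fillDistance D x ^ d * ((1 + 2 * η) *
          (2 * (m : ℝ) / (1 - 2 * η) * I1 R T δ N + 2 * I2 R T δ N)) := by gcongr
    _ = _ := by ring
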